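/- For $n\ge 0$ let $f:\{0,1\}^n\to\{0,1\}$ be drawn uniformly at random from the set of all boolean functions on $n$ bits. For a boolean function $g$ on $n$ bits let $$I[g]=\frac1{2^n}\sum_{x\in\{0,1\}^n}\#\{i: g(x)\ne g(x^{\oplus i})\}$$ be its average sensitivity (total influence), where $x^{\oplus i}$ is $x$ with the $i$-th bit flipped. For $p\in[0,1]$, identify the output bits $0,1$ with $1,-1$, let $$T_{1-2p}f(x)=\mathbb{E}[f(Z)\mid X=x]=\sum_{z\in\{0,1\}^n}p^{d(x,z)}(1-p)^{n-d(x,z)}f(z)$$ be the noise operator, where $Z$ arises from $x$ by flipping each bit independently with probability $p$ and $d$ is the Hamming distance, and let $f_N^*=\operatorname{sign}(T_{1-2p}f)$. Here $\operatorname{sign}(0)\in\{1,-1\}$ is fixed once and for all; either choice is allowed. Then: 1. For every fixed $p\in[0,1]$, as $n\to\infty$, $$\mathbb{E}_f\big[I[f_N^*]\big]\sim\frac n\pi\arccos\!\left(\frac{2p(1-p)}{p^2+(1-p)^2}\right),$$ where $a_n\sim b_n$ means $a_n-b_n=o(b_n)$ (for $p=1/2$ the right-hand side is $0$, and the claim is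 that the left-hand side is $0$ for all large $n$). 2. For every $n$, $\mathbb{E}_f[I[f]]=n/2$. 3. For every $p\in(0,1/2]$ there is $n_0$ (depending on $p$) such that $\mathbb{E}_f[I[f]]>\mathbb{E}_f[I[f_N^*]]$ for all $n\ge n_0$. -/

import Mathlib

open scoped BigOperators

noncomputable section

/-- Boolean functions on `n` bits; as a finite type, it carries the uniform average `𝔼 f`. -/
abbrev BoolFun (n : ℕ) : Type := (Fin n → Bool) → Bool

/-- The bit string `x` with its `i`-th bit flipped. -/
def flipBit {n : ℕ} (i : Fin n) (x : Fin n → Bool) : Fin n → Bool :=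
  Function.update x i (!(x i))

/-- The sensitivity of `f` at `x`: the number of positions whose flip changes the value of `f`. -/
def sensitivityAt {n : ℕ} (f : BoolFun n) (x : Fin n → Bool) : ℕ :=
  (Finset.univ.filter fun i : Fin n => f x ≠ f (flipBit i x)).card

/-- The average sensitivity (total influence) of `f`: the mean of the sensitivity over a uniformly
random input. -/
def avgSensitivity {n : ℕ} (f : BoolFun n) : ℝ :=
  𝔼 x : Fin n → Bool, (sensitivityAt f x : ℝ)

/-- The `±1` representation of a bit: `0 ↦ 1` and `1 ↦ -1`. -/
def pmOne (b : Bool) : ℝ := if b then -1 else 1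

/-- The probability `Pr(Z = z | X = x)` when the bits of `x` are flipped independently so that each
bit, in the `±1` representation, has correlation `ρ` with its noisy copy: a bit is kept with
probability `(1 + ρ) / 2` and flipped with probability `(1 - ρ) / 2`. For `ρ = 1 - 2 * p` the
flip probability is `p`. -/
def noiseKernel {n : ℕ} (ρ : ℝ) (x z : Fin n → Bool) : ℝ :=
  ∏ i : Fin n, if z i = x i then (1 + ρ) / 2 else (1 - ρ) / 2

/-- The noise operator `T_ρ g (x) = E[g(Z) | X = x]`. -/
def noiseOp {n : ℕ} (ρ : ℝ) (g : (Fin n → Bool) → ℝ) (x : Fin n → Bool) : ℝ :=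
  ∑ z : Fin n → Bool, noiseKernel ρ x z * g z

/-- The sign of a real number as a bit, the bit `b` standing for the value `pmOne b`.
The argument `tie` is the bit assigned to `0`. -/
def signBit (tie : Bool) (t : ℝ) : Bool :=
  if 0 < t then false else if t < 0 then true else tie

/-- The optimal predictor `sign (T_{1-2p} f)` for data whose bits are flipped with
probability `p`. -/
def optPredictor {n : ℕ} (tie : Bool) (p : ℝ) (f : BoolFun n) : BoolFun n :=
  fun x => signBit tie (noiseOp (1 - 2 * p) (fun z => pmOne (f z)) x)

end

open MeasureTheory ProbabilityTheory Filter Topology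

/-! ### Averages over boolean functions -/

/-! By linearity the expected influence is an average over `x` of a sum over `i` of the probability
that the predictor changes between the neighbours `x` and `flipBit i x`. Let `A`, `B` be the values
of the noise operator there: two weighted sums of the same random signs, with correlation
`2p(1-p)/Q`, where `Q = p² + (1-p)²`. Up to ties, the predictor changes exactly when `A * B < 0`.

For `0 < p < 1`, `p ≠ 1/2`, put `r = 1 - 2p`. Suitably scaled, `A + B` and `A - B` are the
coordinates of a planar Rademacher sum with identity covariance and uniformly small weights, so the
law tends to the standard Gaussian (`tendsto_charFun_rademacherLaw`). The event becomes the double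
sector `re² < r² im²`, of Gaussian mass `2 arctan|r| / π` (`complexGaussian_sector`), which is the
stated arccosine over `π` (`arccos_eq_two_mul_arctan`). The sector's boundary is null, so ties do
not matter (`flipProb_bounds`).

For `p = 0, 1` the predictor is `f` up to an injective change of input; for `p = 1/2` it is
constant. The strict comparison holds because `0 < p < 1/2` makes the correlation positive and the
arccosine less than `π/2`. -/

theorem expect_avgSensitivity {n : ℕ} (Φ : BoolFun n → BoolFun n) :
    (𝔼 f : BoolFun n, avgSensitivity (Φ f)) =
      𝔼 x : Fin n → Bool, ∑ i : Fin n,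
        𝔼 f : BoolFun n, if Φ f x ≠ Φ f (flipBit i x) then (1 : ℝ) else 0 := by
  simp only [avgSensitivity]
  rw [Finset.expect_comm]
  refine Finset.expect_congr rfl fun x _ => ?_
  rw [← Finset.expect_sum_comm]
  refine Finset.expect_congr rfl fun f _ => ?_
  rw [Finset.sum_boole, sensitivityAt]

theorem flipBit_ne {n : ℕ} (i : Fin n) (x : Fin n → Bool) : x ≠ flipBit i x := by
  intro h
  have := congrFun h i
  simp [flipBit] at this

/-- Two distinct values of a uniformly random boolean function differ with probability `1/2`. -/
theorem expect_ne_eq_half {α : Type*} [Fintype α] [DecidableEq α] {u v : α} (h : u ≠ v) :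
    (𝔼 f : α → Bool, if f u ≠ f v then (1 : ℝ) else 0) = 1 / 2 := by
  -- Negating the value at `u` preserves the uniform law and swaps agreement with disagreement.
  have hinv : Function.Involutive fun f : α → Bool => Function.update f u (!(f u)) := by
    intro f
    simp
  have key : (𝔼 f : α → Bool, if f u ≠ f v then (1 : ℝ) else 0) =
      𝔼 f : α → Bool, if f u ≠ f v then (0 : ℝ) else 1 := by
    refine Fintype.expect_equiv hinv.toPerm _ _ fun f => ?_
    simp only [Function.Involutive.coe_toPerm, Function.update_self,
      Function.update_of_ne h.symm]
    cases f u <;> cases f v <;> simp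
  have hsum : (𝔼 f : α → Bool, if f u ≠ f v then (1 : ℝ) else 0) +
      (𝔼 f : α → Bool, if f u ≠ f v then (0 : ℝ) else 1) = 1 := by
    rw [← Finset.expect_add_distrib, ← Fintype.expect_one (ι := α → Bool) (M := ℝ)]
    refine Finset.expect_congr rfl fun f _ => ?_
    split_ifs <;> simp
  linarith

theorem expect_avgSensitivity_comp {n : ℕ} (Φ : BoolFun n → BoolFun n)
    (σ : (Fin n → Bool) → Fin n → Bool) (hσ : σ.Injective) (hΦ : ∀ f x, Φ f x = f (σ x)) :
    (𝔼 f : BoolFun n, avgSensitivity (Φ f)) = (n : ℝ) / 2 := by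
  rw [expect_avgSensitivity]
  simp only [hΦ]
  simp only [expect_ne_eq_half (hσ.ne (flipBit_ne _ _))]
  simp [div_eq_mul_inv]

/-! ### Characteristic functions of weighted Rademacher sums -/

/-- Both functions are `1 - x²/2 + O(x⁴)` near `0`; for `|x| ≥ 1` their distance is at most `2`
anyway. -/
theorem abs_cos_sub_exp_le (x : ℝ) : |Real.cos x - Real.exp (-(x ^ 2 / 2))| ≤ 2 * x ^ 4 := by
  rcases le_total |x| 1 with hx | hx
  · have h1 := abs_le.1 (Real.cos_bound hx)
    have hx2 : x ^ 2 ≤ 1 := by rw [← sq_abs]; exact pow_le_one₀ (abs_nonneg x) hx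
    have h2 := abs_le.1 (Real.abs_exp_sub_one_sub_id_le (x := -(x ^ 2 / 2))
      (by rw [abs_neg, abs_of_nonneg (by positivity)]; linarith))
    have h4 : |x| ^ 4 = x ^ 4 := by rw [← abs_pow, abs_of_nonneg (by positivity)]
    have h5 : 0 ≤ x ^ 4 := by positivity
    rw [h4] at h1
    rw [abs_le]
    constructor <;> nlinarith
  · have h4 : 1 ≤ x ^ 4 := by
      have : 1 ≤ |x| ^ 4 := one_le_pow₀ hx
      rwa [← abs_pow, abs_of_nonneg (by positivity)] at this
    have h1 := Real.cos_le_one x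
    have h2 := Real.neg_one_le_cos x
    have h3 := Real.exp_pos (-(x ^ 2 / 2))
    have h5 : Real.exp (-(x ^ 2 / 2)) ≤ 1 := Real.exp_le_one_iff.2 (by nlinarith [sq_nonneg x])
    rw [abs_le]
    constructor <;> linarith

/-- Telescoping: factors are replaced one at a time, all others being bounded by `1`. -/
theorem abs_prod_sub_prod_le {ι : Type*} (s : Finset ι) (a b : ι → ℝ)
    (ha : ∀ i, |a i| ≤ 1) (hb : ∀ i, |b i| ≤ 1) :
    |∏ i ∈ s, a i - ∏ i ∈ s, b i| ≤ ∑ i ∈ s, |a i - b i| := by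
  classical
  induction s using Finset.induction_on with
  | empty => simp
  | insert j s hj ih =>
    rw [Finset.prod_insert hj, Finset.prod_insert hj, Finset.sum_insert hj]
    have hB : |∏ i ∈ s, b i| ≤ 1 := by
      rw [Finset.abs_prod]
      exact Finset.prod_le_one (fun i _ => abs_nonneg _) fun i _ => hb i
    calc |a j * ∏ i ∈ s, a i - b j * ∏ i ∈ s, b i|
        = |a j * (∏ i ∈ s, a i - ∏ i ∈ s, b i) + (a j - b j) * ∏ i ∈ s, b i| := by ring_nf
      _ ≤ |a j| * |∏ i ∈ s, a i - ∏ i ∈ s, b i| + |a j - b j| * |∏ i ∈ s, b i| := by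
          rw [← abs_mul, ← abs_mul]; exact abs_add_le _ _
      _ ≤ 1 * ∑ i ∈ s, |a i - b i| + |a j - b j| * 1 := by
          gcongr
          exact ha j
      _ = _ := by ring

/-- A quantitative form of the convergence of `∏ cos cᵢ` to the Gaussian characteristic
function. -/
theorem abs_prod_cos_sub_exp_le {ι : Type*} [Fintype ι] (c : ι → ℝ) {δ : ℝ}
    (hδ : ∀ i, |c i| ≤ δ) :
    |∏ i, Real.cos (c i) - Real.exp (-((∑ i, c i ^ 2) / 2))| ≤ 2 * δ ^ 2 * ∑ i, c i ^ 2 := by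
  have h : Real.exp (-((∑ i, c i ^ 2) / 2)) = ∏ i, Real.exp (-(c i ^ 2 / 2)) := by
    rw [← Real.exp_sum, Finset.sum_neg_distrib, Finset.sum_div]
  rw [h]
  refine (abs_prod_sub_prod_le _ _ _ (fun i => Real.abs_cos_le_one _) fun i => ?_).trans ?_
  · rw [Real.abs_exp]
    exact Real.exp_le_one_iff.2 (by nlinarith [sq_nonneg (c i)])
  · rw [Finset.mul_sum]
    refine Finset.sum_le_sum fun i _ => (abs_cos_sub_exp_le _).trans ?_
    have h2 : c i ^ 2 ≤ δ ^ 2 := sq_le_sq' (abs_le.1 (hδ i)).1 (abs_le.1 (hδ i)).2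
    nlinarith [sq_nonneg (c i)]

/-- Independence of the signs: the average over `f` factors over coordinates, each contributing
`(e^{ic} + e^{-ic})/2`. -/
theorem expect_exp_rademacher {ι : Type*} [Fintype ι] [DecidableEq ι] (c : ι → ℝ) :
    (𝔼 f : ι → Bool, Complex.exp ((∑ i, pmOne (f i) * c i : ℝ) * Complex.I)) =
      ((∏ i, Real.cos (c i) : ℝ) : ℂ) := by
  have h : ∀ i, ((Real.cos (c i) : ℝ) : ℂ) =
      ∑ b : Bool, Complex.exp ((pmOne b * c i : ℝ) * Complex.I) / 2 := by
    intro i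
    rw [Complex.ofReal_cos, Complex.cos]
    simp [pmOne]
    ring
  rw [Complex.ofReal_prod]
  simp_rw [h]
  rw [Fintype.prod_sum, Fintype.expect_eq_sum_div_card, Finset.sum_div]
  refine Finset.sum_congr rfl fun f _ => ?_
  rw [Finset.prod_div_distrib, ← Complex.exp_sum, Complex.ofReal_sum, Finset.sum_mul]
  simp

/-! ### Angular sectors under the standard Gaussian measure of the plane -/

/-- The standard Gaussian measure on `ℂ`, as the law of `X + iY` for independent standard
normal `X` and `Y`. -/
noncomputable def complexGaussian : Measure ℂ :=
  ((gaussianReal 0 1).prod (gaussianReal 0 1)).map Complex.measurableEquivRealProd.symm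

instance : IsProbabilityMeasure complexGaussian :=
  Measure.isProbabilityMeasure_map (Complex.measurableEquivRealProd.symm.measurable.aemeasurable)

theorem charFun_complexGaussian (t : ℂ) :
    charFun complexGaussian t = ((Real.exp (-(‖t‖ ^ 2 / 2)) : ℝ) : ℂ) := by
  have h1 : ∀ q : ℝ × ℝ, Complex.exp (inner ℝ (Complex.measurableEquivRealProd.symm q) t *
      Complex.I) = Complex.exp (t.re * q.1 * Complex.I) * Complex.exp (t.im * q.2 * Complex.I) := by
    intro q
    rw [← Complex.exp_add]
    congr 1
    simp [Complex.inner, Complex.measurableEquivRealProd_symm_apply]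
    ring
  rw [charFun_apply, complexGaussian, integral_map_equiv]
  simp_rw [h1]
  rw [integral_prod_mul (fun x : ℝ => Complex.exp (t.re * x * Complex.I))
    (fun y : ℝ => Complex.exp (t.im * y * Complex.I)), ← charFun_apply_real,
    ← charFun_apply_real, charFun_gaussianReal, charFun_gaussianReal, ← Complex.exp_add,
    Complex.ofReal_exp]
  congr 1
  rw [← Complex.normSq_eq_norm_sq, Complex.normSq_apply]
  push_cast
  ring

/-- The standard Gaussian measure of a cone is proportional to its opening angle. -/
theorem complexGaussian_cone {D : Set ℂ} (hD : MeasurableSet D) {T : Set ℝ}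
    (hT : MeasurableSet T)
    (h : ∀ r θ : ℝ, 0 < r → (r * (Real.cos θ + Real.sin θ * Complex.I) ∈ D ↔ θ ∈ T)) :
    complexGaussian D =
      ENNReal.ofReal (1 / (2 * Real.pi)) * volume (Set.Ioo (-Real.pi) Real.pi ∩ T) := by
  -- The radial integral in polar coordinates. It is never computed: taking the whole plane as the
  -- cone forces its value.
  set C : ENNReal := ∫⁻ r in Set.Ioi (0 : ℝ),
    ENNReal.ofReal r * ENNReal.ofReal ((2 * Real.pi)⁻¹ * Real.exp (-(r ^ 2 / 2))) with hC
  have main : ∀ (D : Set ℂ) (_ : MeasurableSet D) (T : Set ℝ) (_ : MeasurableSet T)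
      (_ : ∀ r θ : ℝ, 0 < r → (r * (Real.cos θ + Real.sin θ * Complex.I) ∈ D ↔ θ ∈ T)),
      complexGaussian D = C * volume (Set.Ioo (-Real.pi) Real.pi ∩ T) := by
    intro D hD T hT h
    have hpre := Complex.measurableEquivRealProd.symm.measurable hD
    rw [complexGaussian, Measure.map_apply Complex.measurableEquivRealProd.symm.measurable hD,
      gaussianReal_of_var_ne_zero _ one_ne_zero,
      prod_withDensity (measurable_gaussianPDF _ _) (measurable_gaussianPDF _ _),
      withDensity_apply _ hpre, ← lintegral_indicator hpre, ← Measure.volume_eq_prod,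
      ← lintegral_comp_polarCoord_symm, hC]
    have hset : volume (Set.Ioo (-Real.pi) Real.pi ∩ T) =
        ∫⁻ θ in Set.Ioo (-Real.pi) Real.pi, T.indicator 1 θ := by
      rw [lintegral_indicator_one hT, Measure.restrict_apply hT, Set.inter_comm]
    rw [hset, ← lintegral_prod_mul (by fun_prop)
      ((measurable_one.indicator hT).aemeasurable), Measure.prod_restrict,
      ← Measure.volume_eq_prod, polarCoord_target]
    refine setLIntegral_congr_fun (measurableSet_Ioi.prod measurableSet_Ioo) fun q hq => ?_
    have hq1 : 0 < q.1 := hq.1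
    have hmem : polarCoord.symm q ∈ Complex.measurableEquivRealProd.symm ⁻¹' D ↔ q.2 ∈ T := by
      rw [← h q.1 q.2 hq1, Set.mem_preimage,
        Complex.measurableEquivRealProd_symm_polarCoord_symm_apply,
        Complex.polarCoord_symm_apply]
    by_cases hqT : q.2 ∈ T
    · simp only [Set.indicator_of_mem (hmem.2 hqT), Set.indicator_of_mem hqT, smul_eq_mul,
        Pi.one_apply, mul_one]
      congr 1
      rw [gaussianPDF, gaussianPDF, ← ENNReal.ofReal_mul (gaussianPDFReal_nonneg _ _ _)]
      congr 1
      simp only [gaussianPDFReal, polarCoord_symm_apply, NNReal.coe_one, mul_one, sub_zero]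
      rw [mul_mul_mul_comm, ← Real.exp_add, ← mul_inv, Real.mul_self_sqrt (by positivity)]
      congr 2
      have := Real.sin_sq_add_cos_sq q.2
      linear_combination (-q.1 ^ 2 / 2) * this
    · simp only [Set.indicator_of_notMem (fun hh => hqT (hmem.1 hh)),
        Set.indicator_of_notMem hqT, smul_zero, mul_zero]
  have huniv := main Set.univ MeasurableSet.univ Set.univ MeasurableSet.univ (by simp)
  have hC' : C = ENNReal.ofReal (1 / (2 * Real.pi)) := by
    rw [measure_univ, Set.inter_univ, Real.volume_Ioo] at huniv
    have h2 : Real.pi - -Real.pi = 2 * Real.pi := by ring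
    rw [h2] at huniv
    rw [one_div, ENNReal.ofReal_inv_of_pos (by positivity)]
    exact ENNReal.eq_inv_of_mul_eq_one_left huniv.symm
  rw [← hC']
  exact main D hD T hT h

theorem cos_two_mul_lt_iff {β θ : ℝ} (hβ0 : 0 < β) (hβπ : β < Real.pi) (h0 : 0 ≤ θ)
    (hπ : θ ≤ Real.pi) :
    Real.cos (2 * θ) < Real.cos β ↔ β / 2 < θ ∧ θ < Real.pi - β / 2 := by
  have hβ : β ∈ Set.Icc 0 Real.pi := ⟨hβ0.le, hβπ.le⟩
  rcases le_total (2 * θ) Real.pi with hle | hle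
  · rw [Real.strictAntiOn_cos.lt_iff_gt ⟨by linarith, hle⟩ hβ]
    constructor
    · intro h; constructor <;> linarith
    · intro h; linarith
  · rw [← Real.cos_two_pi_sub, Real.strictAntiOn_cos.lt_iff_gt ⟨by linarith, by linarith⟩ hβ]
    constructor
    · intro h; constructor <;> linarith
    · intro h; linarith

theorem volume_cos_two_mul_lt {β : ℝ} (hβ0 : 0 < β) (hβπ : β < Real.pi) :
    volume (Set.Ioo (-Real.pi) Real.pi ∩ {θ | Real.cos (2 * θ) < Real.cos β}) =
      ENNReal.ofReal (2 * (Real.pi - β)) := by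
  have hset : Set.Ioo (-Real.pi) Real.pi ∩ {θ | Real.cos (2 * θ) < Real.cos β} =
      Set.Ioo (-(Real.pi - β / 2)) (-(β / 2)) ∪ Set.Ioo (β / 2) (Real.pi - β / 2) := by
    ext θ
    simp only [Set.mem_inter_iff, Set.mem_Ioo, Set.mem_ofPred_eq, Set.mem_union]
    constructor
    · rintro ⟨⟨h1, h2⟩, h3⟩
      rcases le_total 0 θ with h | h
      · exact Or.inr ((cos_two_mul_lt_iff hβ0 hβπ h h2.le).1 h3)
      · rw [← Real.cos_neg, ← mul_neg] at h3
        have := (cos_two_mul_lt_iff hβ0 hβπ (θ := -θ) (by linarith) (by linarith)).1 h3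
        exact Or.inl ⟨by linarith, by linarith⟩
    · rintro (h | h)
      · refine ⟨⟨by linarith, by linarith⟩, ?_⟩
        rw [← Real.cos_neg, ← mul_neg]
        exact (cos_two_mul_lt_iff hβ0 hβπ (by linarith) (by linarith)).2
          ⟨by linarith, by linarith⟩
      · exact ⟨⟨by linarith, by linarith⟩,
          (cos_two_mul_lt_iff hβ0 hβπ (by linarith) (by linarith)).2 h⟩
  rw [hset, measure_union _ measurableSet_Ioo, Real.volume_Ioo, Real.volume_Ioo,
    ← ENNReal.ofReal_add (by linarith) (by linarith)]
  · congr 1; ring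
  · rw [Set.disjoint_left]
    intro θ h1 h2
    linarith [h1.2, h2.1]

/-- Reduces the quadratic cone to a condition on the angle alone, since `cos (2 arctan |r|) = (1 -
r²)/(1 + r²)`. -/
theorem cos_sq_sub_mul_sin_sq (r θ : ℝ) :
    Real.cos θ ^ 2 - r ^ 2 * Real.sin θ ^ 2 =
      (1 + r ^ 2) / 2 *
        (Real.cos (2 * θ) - Real.cos (Real.pi - 2 * Real.arctan |r|)) := by
  rw [Real.cos_pi_sub, Real.cos_two_mul, Real.cos_two_mul, Real.cos_sq_arctan, sq_abs,
    Real.sin_sq]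
  field_simp
  ring

theorem re_sq_sub_mul_im_sq_polar (r ρ θ : ℝ) :
    ((ρ : ℂ) * (Real.cos θ + Real.sin θ * Complex.I)).re ^ 2 -
        r ^ 2 * ((ρ : ℂ) * (Real.cos θ + Real.sin θ * Complex.I)).im ^ 2 =
      ρ ^ 2 * ((1 + r ^ 2) / 2) *
        (Real.cos (2 * θ) - Real.cos (Real.pi - 2 * Real.arctan |r|)) := by
  have h1 : ((ρ : ℂ) * (Real.cos θ + Real.sin θ * Complex.I)).re = ρ * Real.cos θ := by
    simp [-Complex.ofReal_cos, -Complex.ofReal_sin]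
  have h2 : ((ρ : ℂ) * (Real.cos θ + Real.sin θ * Complex.I)).im = ρ * Real.sin θ := by
    simp [-Complex.ofReal_cos, -Complex.ofReal_sin]
  rw [h1, h2, mul_assoc, ← cos_sq_sub_mul_sin_sq]
  ring

theorem complexGaussian_sector {r : ℝ} (hr : r ≠ 0) :
    complexGaussian {w : ℂ | w.re ^ 2 < r ^ 2 * w.im ^ 2} =
      ENNReal.ofReal (2 * Real.arctan |r| / Real.pi) := by
  have hα : 0 < Real.arctan |r| := Real.arctan_pos.2 (abs_pos.2 hr)
  have hα2 := Real.arctan_lt_pi_div_two |r|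
  rw [complexGaussian_cone (T := {θ | Real.cos (2 * θ) <
      Real.cos (Real.pi - 2 * Real.arctan |r|)})
      (measurableSet_lt (by fun_prop) (by fun_prop))
      (measurableSet_lt (by fun_prop) (by fun_prop)),
    volume_cos_two_mul_lt (by linarith) (by linarith), ← ENNReal.ofReal_mul (by positivity)]
  · congr 1
    field_simp
    ring
  · intro ρ θ hρ
    rw [Set.mem_ofPred_eq, Set.mem_ofPred_eq, ← sub_neg, re_sq_sub_mul_im_sq_polar,
      ← smul_eq_mul, smul_neg_iff_of_pos_left (by positivity), sub_neg]

theorem complexGaussian_lines (r : ℝ) :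
    complexGaussian {w : ℂ | w.re ^ 2 = r ^ 2 * w.im ^ 2} = 0 := by
  rw [complexGaussian_cone (T := {θ | Real.cos (2 * θ) =
      Real.cos (Real.pi - 2 * Real.arctan |r|)})
      (measurableSet_eq_fun (by fun_prop) (by fun_prop))
      (measurableSet_eq_fun (by fun_prop) (by fun_prop))]
  · rw [mul_eq_zero]
    refine Or.inr (measure_mono_null Set.inter_subset_right ?_)
    refine Set.Countable.measure_zero ?_ _
    -- The boundary angles solve `cos 2θ = cos β`, so they are countably many.
    set β := Real.pi - 2 * Real.arctan |r|
    refine (Set.countable_iUnion fun k : ℤ =>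
      ((Set.countable_singleton ((β + 2 * k * Real.pi) / 2)).insert
        ((2 * k * Real.pi - β) / 2))).mono
      fun θ hθ => ?_
    obtain ⟨k, hk | hk⟩ := Real.cos_eq_cos_iff.1 hθ
    · refine Set.mem_iUnion.2 ⟨-k, Or.inr ?_⟩
      rw [Set.mem_singleton_iff]
      push_cast
      linarith
    · exact Set.mem_iUnion.2 ⟨k, Or.inl (by linarith)⟩
  · intro ρ θ hρ
    have h : ρ ^ 2 * ((1 + r ^ 2) / 2) ≠ 0 := by positivity
    rw [Set.mem_ofPred_eq, Set.mem_ofPred_eq, ← sub_eq_zero, re_sq_sub_mul_im_sq_polar,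
      mul_eq_zero_iff_left h, sub_eq_zero]

/-! ### The central limit theorem for planar weighted Rademacher sums -/

/-- The law of `∑ i, ε i • a i` for independent uniform signs `ε i`. -/
noncomputable def rademacherLaw {ι : Type*} [Fintype ι] [DecidableEq ι] (a : ι → ℂ) : Measure ℂ :=
  ∑ f : ι → Bool, ENNReal.ofReal (Fintype.card (ι → Bool) : ℝ)⁻¹ •
    Measure.dirac (∑ i, pmOne (f i) • a i)

theorem rademacherLaw_real_apply {ι : Type*} [Fintype ι] [DecidableEq ι] (a : ι → ℂ) {s : Set ℂ}
    [DecidablePred (· ∈ s)] (hs : MeasurableSet s) :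
    (rademacherLaw a).real s =
      𝔼 f : ι → Bool, if ∑ i, pmOne (f i) • a i ∈ s then (1 : ℝ) else 0 := by
  rw [Measure.real, rademacherLaw, Measure.finsetSum_apply, ENNReal.toReal_sum,
    Fintype.expect_eq_sum_div_card, Finset.sum_div]
  · refine Finset.sum_congr rfl fun f _ => ?_
    rw [Measure.smul_apply, Measure.dirac_apply' _ hs, smul_eq_mul, ENNReal.toReal_mul,
      ENNReal.toReal_ofReal (by positivity)]
    by_cases h : ∑ i, pmOne (f i) • a i ∈ s
    · rw [Set.indicator_of_mem h, if_pos h, Pi.one_apply, ENNReal.toReal_one, mul_one, one_div]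
    · rw [Set.indicator_of_notMem h, if_neg h, ENNReal.toReal_zero, mul_zero, zero_div]
  · intro f _
    exact ENNReal.mul_ne_top ENNReal.ofReal_ne_top (measure_ne_top _ _)

instance {ι : Type*} [Fintype ι] [DecidableEq ι] (a : ι → ℂ) :
    IsProbabilityMeasure (rademacherLaw a) := by
  classical
  constructor
  have h := rademacherLaw_real_apply a MeasurableSet.univ
  simp only [Set.mem_univ, if_true, Fintype.expect_const] at h
  exact (ENNReal.toReal_eq_one_iff _).1 h

theorem integral_rademacherLaw {ι : Type*} [Fintype ι] [DecidableEq ι] (a : ι → ℂ) (g : ℂ → ℂ) :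
    ∫ w, g w ∂(rademacherLaw a) = 𝔼 f : ι → Bool, g (∑ i, pmOne (f i) • a i) := by
  rw [rademacherLaw, integral_finsetSum_measure, Fintype.expect_eq_sum_div_card, Finset.sum_div]
  · refine Finset.sum_congr rfl fun f _ => ?_
    rw [integral_smul_measure, integral_dirac, ENNReal.toReal_ofReal (by positivity),
      Complex.real_smul]
    push_cast
    ring
  · intro f _
    exact (integrable_dirac (by simp)).smul_measure ENNReal.ofReal_ne_top

theorem charFun_rademacherLaw {ι : Type*} [Fintype ι] [DecidableEq ι] (a : ι → ℂ) (t : ℂ) :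
    charFun (rademacherLaw a) t = ((∏ i, Real.cos (inner ℝ (a i) t) : ℝ) : ℂ) := by
  rw [charFun_apply, integral_rademacherLaw, ← expect_exp_rademacher]
  refine Finset.expect_congr rfl fun f _ => ?_
  simp only [sum_inner, real_inner_smul_left]

/-- If the weights are isotropic and uniformly small, the characteristic functions of the
weighted Rademacher sums converge to that of the standard Gaussian. -/
theorem tendsto_charFun_rademacherLaw {ι : ℕ → Type*} [∀ n, Fintype (ι n)]
    [∀ n, DecidableEq (ι n)] (a : ∀ n, ι n → ℂ) (δ : ℕ → ℝ) (hδ : Tendsto δ atTop (𝓝 0))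
    (ha : ∀ n i, ‖a n i‖ ≤ δ n) (hvar : ∀ n t, ∑ i, inner ℝ (a n i) t ^ 2 = ‖t‖ ^ 2) (t : ℂ) :
    Tendsto (fun n => charFun (rademacherLaw (a n)) t) atTop
      (𝓝 (charFun complexGaussian t)) := by
  simp only [charFun_rademacherLaw, charFun_complexGaussian]
  refine (Complex.continuous_ofReal.tendsto _).comp ?_
  rw [tendsto_iff_dist_tendsto_zero]
  have hlim : Tendsto (fun n => 2 * (δ n * ‖t‖) ^ 2 * ‖t‖ ^ 2) atTop (𝓝 0) := by
    have := (((hδ.mul_const ‖t‖).pow 2).const_mul 2).mul_const (‖t‖ ^ 2)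
    simpa using this
  refine squeeze_zero (fun _ => dist_nonneg) (fun n => ?_) hlim
  rw [Real.dist_eq, ← hvar n t]
  refine abs_prod_cos_sub_exp_le _ fun i => ?_
  refine (abs_real_inner_le_norm _ _).trans ?_
  gcongr
  exact ha n i

/-- Lévy continuity and the portmanteau theorem, the frontiers being null. The open and closed
sectors are both needed, to sandwich the ties. -/
theorem tendsto_rademacherLaw_sector {ι : ℕ → Type*} [∀ n, Fintype (ι n)]
    [∀ n, DecidableEq (ι n)] (a : ∀ n, ι n → ℂ) (δ : ℕ → ℝ) (hδ : Tendsto δ atTop (𝓝 0))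
    (ha : ∀ n i, ‖a n i‖ ≤ δ n) (hvar : ∀ n t, ∑ i, inner ℝ (a n i) t ^ 2 = ‖t‖ ^ 2)
    {r : ℝ} (hr : r ≠ 0) :
    Tendsto (fun n => (rademacherLaw (a n)).real {w : ℂ | w.re ^ 2 < r ^ 2 * w.im ^ 2}) atTop
        (𝓝 (2 * Real.arctan |r| / Real.pi)) ∧
      Tendsto (fun n => (rademacherLaw (a n)).real {w : ℂ | w.re ^ 2 ≤ r ^ 2 * w.im ^ 2}) atTop
        (𝓝 (2 * Real.arctan |r| / Real.pi)) := by
  let γ : ProbabilityMeasure ℂ := ⟨complexGaussian, inferInstance⟩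
  let μ : ℕ → ProbabilityMeasure ℂ := fun n => ⟨rademacherLaw (a n), inferInstance⟩
  have hconv : Tendsto μ atTop (𝓝 γ) :=
    ProbabilityMeasure.tendsto_of_tendsto_charFun
      (tendsto_charFun_rademacherLaw a δ hδ ha hvar)
  have hlt := complexGaussian_sector hr
  have hle : complexGaussian {w : ℂ | w.re ^ 2 ≤ r ^ 2 * w.im ^ 2} =
      ENNReal.ofReal (2 * Real.arctan |r| / Real.pi) := by
    have hset : {w : ℂ | w.re ^ 2 ≤ r ^ 2 * w.im ^ 2} =
        {w : ℂ | w.re ^ 2 < r ^ 2 * w.im ^ 2} ∪ {w : ℂ | w.re ^ 2 = r ^ 2 * w.im ^ 2} := by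
      ext w
      simp only [Set.mem_union, Set.mem_ofPred_eq]
      exact le_iff_lt_or_eq
    refine le_antisymm ((hset ▸ measure_union_le _ _).trans ?_)
      (hlt ▸ measure_mono (hset ▸ Set.subset_union_left))
    rw [complexGaussian_lines, add_zero, hlt]
  have hc1 : Continuous fun w : ℂ => w.re ^ 2 := Complex.continuous_re.pow 2
  have hc2 : Continuous fun w : ℂ => r ^ 2 * w.im ^ 2 := (Complex.continuous_im.pow 2).const_mul _
  have hpos : 0 ≤ 2 * Real.arctan |r| / Real.pi := by
    have : 0 ≤ Real.arctan |r| := Real.arctan_nonneg.2 (abs_nonneg r)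
    positivity
  have key : ∀ s : Set ℂ, complexGaussian (frontier s) = 0 →
      complexGaussian s = ENNReal.ofReal (2 * Real.arctan |r| / Real.pi) →
      Tendsto (fun n => (rademacherLaw (a n)).real s) atTop
        (𝓝 (2 * Real.arctan |r| / Real.pi)) := by
    intro s hs hs'
    have h := ProbabilityMeasure.tendsto_measure_of_null_frontier_of_tendsto' hconv hs
    have h2 := (ENNReal.tendsto_toReal (measure_ne_top complexGaussian s)).comp h
    rwa [hs', ENNReal.toReal_ofReal hpos] at h2
  exact ⟨key _ (measure_mono_null (frontier_lt_subset_eq hc1 hc2) (complexGaussian_lines r)) hlt,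
    key _ (measure_mono_null (frontier_le_subset_eq hc1 hc2) (complexGaussian_lines r)) hle⟩

/-! ### The noise kernel -/

/-- The covariance of the noisy averages at `x` and `y`; it factors over coordinates because the
kernel is a product. -/
theorem sum_noiseKernel_mul {n : ℕ} (ρ : ℝ) (x y : Fin n → Bool) :
    ∑ z, noiseKernel ρ x z * noiseKernel ρ y z =
      ∏ i, if x i = y i then ((1 + ρ) / 2) ^ 2 + ((1 - ρ) / 2) ^ 2
        else 2 * ((1 - ρ) / 2) * ((1 + ρ) / 2) := by
  simp only [noiseKernel, ← Finset.prod_mul_distrib]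
  rw [← Fintype.prod_sum fun i b => (if b = x i then (1 + ρ) / 2 else (1 - ρ) / 2) *
    (if b = y i then (1 + ρ) / 2 else (1 - ρ) / 2)]
  refine Finset.prod_congr rfl fun i _ => ?_
  rw [Fintype.sum_bool]
  cases x i <;> cases y i <;> simp <;> ring

theorem sum_noiseKernel_sq {n : ℕ} (p : ℝ) (x : Fin n → Bool) :
    ∑ z, noiseKernel (1 - 2 * p) x z ^ 2 = (p ^ 2 + (1 - p) ^ 2) ^ n := by
  simp only [sq (noiseKernel _ _ _)]
  rw [sum_noiseKernel_mul]
  simp only [if_true, Finset.prod_const, Finset.card_univ, Fintype.card_fin]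
  ring_nf

theorem sum_noiseKernel_mul_flipBit {n : ℕ} (p : ℝ) (x : Fin (n + 1) → Bool) (i : Fin (n + 1)) :
    ∑ z, noiseKernel (1 - 2 * p) x z * noiseKernel (1 - 2 * p) (flipBit i x) z =
      2 * p * (1 - p) * (p ^ 2 + (1 - p) ^ 2) ^ n := by
  rw [sum_noiseKernel_mul, Fin.prod_univ_succAbove _ i]
  have h : ∀ j : Fin n, flipBit i x (i.succAbove j) = x (i.succAbove j) := fun j => by
    simp [flipBit]
  have hi : x i ≠ flipBit i x i := by simp [flipBit]
  simp only [h, hi, if_true, if_false, Finset.prod_const, Finset.card_univ, Fintype.card_fin]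
  ring_nf

theorem noiseKernel_nonneg {n : ℕ} {p : ℝ} (h0 : 0 ≤ p) (h1 : p ≤ 1) (x z : Fin n → Bool) :
    0 ≤ noiseKernel (1 - 2 * p) x z := by
  refine Finset.prod_nonneg fun i _ => ?_
  split_ifs <;> linarith

theorem noiseKernel_le {n : ℕ} {p : ℝ} (h0 : 0 ≤ p) (h1 : p ≤ 1) (x z : Fin n → Bool) :
    noiseKernel (1 - 2 * p) x z ≤ max p (1 - p) ^ n := by
  have h : noiseKernel (1 - 2 * p) x z ≤ ∏ _i : Fin n, max p (1 - p) := by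
    refine Finset.prod_le_prod (fun i _ => ?_) fun i _ => ?_
    · split_ifs <;> linarith
    · split_ifs
      · exact le_trans (by linarith) (le_max_right _ _)
      · exact le_trans (by linarith) (le_max_left _ _)
  simpa using h

/-! ### The pair of noisy averages at neighbouring inputs -/

/-- The weight with which `z` enters the normalised sum and difference of the noise operator at
`x` and at `flipBit i x`. -/
noncomputable def neighborWeight {n : ℕ} (p : ℝ) (x : Fin (n + 1) → Bool) (i : Fin (n + 1))
    (z : Fin (n + 1) → Bool) : ℂ :=
  ⟨(noiseKernel (1 - 2 * p) x z + noiseKernel (1 - 2 * p) (flipBit i x) z) /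
      √(2 * (p ^ 2 + (1 - p) ^ 2) ^ n),
    (noiseKernel (1 - 2 * p) x z - noiseKernel (1 - 2 * p) (flipBit i x) z) /
      (√(2 * (p ^ 2 + (1 - p) ^ 2) ^ n) * (1 - 2 * p))⟩

theorem sq_add_one_sub_sq_pos (p : ℝ) : 0 < p ^ 2 + (1 - p) ^ 2 := by
  nlinarith [sq_nonneg (1 - 2 * p)]

/-- In dimension `n + 1`, `A` and `B` have variance `Q ^ (n + 1)` and covariance `2p(1-p) Q ^ n`, so
`A ± B` are uncorrelated. As `Q + 2p(1-p) = 1` and `Q - 2p(1-p) = (1-2p)²`, their variances are `2Q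
^ n` and `2Q ^ n (1-2p)²`, which the weights normalise to `1`. -/
theorem sum_inner_neighborWeight_sq {n : ℕ} {p : ℝ} (hp : 1 - 2 * p ≠ 0)
    (x : Fin (n + 1) → Bool) (i : Fin (n + 1)) (t : ℂ) :
    ∑ z, inner ℝ (neighborWeight p x i z) t ^ 2 = ‖t‖ ^ 2 := by
  have hQ := sq_add_one_sub_sq_pos p
  set s := √(2 * (p ^ 2 + (1 - p) ^ 2) ^ n) with hs
  have hs0 : s ≠ 0 := by positivity
  have hs2 : s ^ 2 = 2 * (p ^ 2 + (1 - p) ^ 2) ^ n := Real.sq_sqrt (by positivity)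
  set r := 1 - 2 * p with hr
  have hexp : ∀ z, inner ℝ (neighborWeight p x i z) t ^ 2 =
      (t.re / s + t.im / (s * r)) ^ 2 * noiseKernel r x z ^ 2 +
      (t.re / s - t.im / (s * r)) ^ 2 * noiseKernel r (flipBit i x) z ^ 2 +
      2 * (t.re / s + t.im / (s * r)) * (t.re / s - t.im / (s * r)) *
        (noiseKernel r x z * noiseKernel r (flipBit i x) z) := by
    intro z
    simp only [neighborWeight, Complex.inner, ← hs, ← hr]
    simp
    ring
  simp only [hexp]
  rw [Finset.sum_add_distrib, Finset.sum_add_distrib, ← Finset.mul_sum, ← Finset.mul_sum,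
    ← Finset.mul_sum, hr, sum_noiseKernel_sq, sum_noiseKernel_sq, sum_noiseKernel_mul_flipBit,
    ← hr, ← Complex.normSq_eq_norm_sq, Complex.normSq_apply, pow_succ (p ^ 2 + (1 - p) ^ 2) n]
  have hQn : (p ^ 2 + (1 - p) ^ 2) ^ n = s ^ 2 / 2 := by rw [hs2]; ring
  rw [hQn]
  field_simp
  rw [hr]
  ring

theorem norm_neighborWeight_le {n : ℕ} {p : ℝ} (h0 : 0 ≤ p) (h1 : p ≤ 1)
    (x : Fin (n + 1) → Bool) (i : Fin (n + 1)) (z : Fin (n + 1) → Bool) :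
    ‖neighborWeight p x i z‖ ≤
      2 * max p (1 - p) * (1 + 1 / |1 - 2 * p|) / √2 *
        (max p (1 - p) / √(p ^ 2 + (1 - p) ^ 2)) ^ n := by
  have hQ := sq_add_one_sub_sq_pos p
  have hs : √(2 * (p ^ 2 + (1 - p) ^ 2) ^ n) = √2 * √(p ^ 2 + (1 - p) ^ 2) ^ n := by
    rw [Real.sqrt_mul (by norm_num)]
    congr 1
    rw [Real.sqrt_eq_iff_mul_self_eq (by positivity) (by positivity), ← mul_pow,
      Real.mul_self_sqrt hQ.le]
  set M := max p (1 - p)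
  have ha := noiseKernel_nonneg h0 h1 x z
  have hb := noiseKernel_nonneg h0 h1 (flipBit i x) z
  have ha' := noiseKernel_le h0 h1 x z
  have hb' := noiseKernel_le h0 h1 (flipBit i x) z
  refine (Complex.norm_le_abs_re_add_abs_im _).trans ?_
  simp only [neighborWeight, hs]
  set s := √2 * √(p ^ 2 + (1 - p) ^ 2) ^ n with hs'
  have hs0 : 0 < s := by positivity
  have e : 2 * M * (1 + 1 / |1 - 2 * p|) / √2 * (M / √(p ^ 2 + (1 - p) ^ 2)) ^ n =
      2 * M ^ (n + 1) / s + 2 * M ^ (n + 1) / (s * |1 - 2 * p|) := by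
    rw [hs', div_pow, pow_succ]
    simp only [div_eq_mul_inv, mul_inv]
    ring
  rw [e, abs_div, abs_div, abs_mul s, abs_of_pos hs0]
  gcongr
  · rw [abs_le]; constructor <;> linarith
  · rw [abs_le]; constructor <;> linarith

theorem tendsto_neighborWeight_bound {p : ℝ} (h0 : 0 < p) (h1 : p < 1) :
    Tendsto (fun n : ℕ => 2 * max p (1 - p) * (1 + 1 / |1 - 2 * p|) / √2 *
      (max p (1 - p) / √(p ^ 2 + (1 - p) ^ 2)) ^ n) atTop (𝓝 0) := by
  have hQ := sq_add_one_sub_sq_pos p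
  have hM : 0 < max p (1 - p) := lt_max_of_lt_left h0
  -- Strict because neither `p` nor `1 - p` vanishes; at `p = 0, 1` one weight dominates and the
  -- Gaussian limit fails.
  have hlt : max p (1 - p) / √(p ^ 2 + (1 - p) ^ 2) < 1 := by
    rw [div_lt_one (by positivity)]
    refine max_lt (Real.lt_sqrt_of_sq_lt ?_) (Real.lt_sqrt_of_sq_lt ?_) <;> nlinarith
  have := (tendsto_pow_atTop_nhds_zero_of_lt_one (by positivity) hlt).const_mul
    (2 * max p (1 - p) * (1 + 1 / |1 - 2 * p|) / √2)
  simpa using this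

theorem sum_pmOne_smul_neighborWeight {n : ℕ} (p : ℝ) (x : Fin (n + 1) → Bool)
    (i : Fin (n + 1)) (f : BoolFun (n + 1)) :
    ∑ z, pmOne (f z) • neighborWeight p x i z =
      ⟨(noiseOp (1 - 2 * p) (fun z => pmOne (f z)) x +
          noiseOp (1 - 2 * p) (fun z => pmOne (f z)) (flipBit i x)) /
          √(2 * (p ^ 2 + (1 - p) ^ 2) ^ n),
        (noiseOp (1 - 2 * p) (fun z => pmOne (f z)) x -
          noiseOp (1 - 2 * p) (fun z => pmOne (f z)) (flipBit i x)) /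
          (√(2 * (p ^ 2 + (1 - p) ^ 2) ^ n) * (1 - 2 * p))⟩ := by
  apply Complex.ext
  · simp only [Complex.re_sum, Complex.smul_re, neighborWeight, noiseOp, smul_eq_mul,
      ← Finset.sum_add_distrib, Finset.sum_div]
    exact Finset.sum_congr rfl fun z _ => by ring
  · simp only [Complex.im_sum, Complex.smul_im, neighborWeight, noiseOp, smul_eq_mul,
      ← Finset.sum_sub_distrib, Finset.sum_div]
    exact Finset.sum_congr rfl fun z _ => by ring

theorem sq_normalized_sub (A B : ℝ) {s r : ℝ} (hr : r ≠ 0) :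
    ((A + B) / s) ^ 2 - r ^ 2 * ((A - B) / (s * r)) ^ 2 = 4 / s ^ 2 * (A * B) := by
  rw [div_pow, div_pow, mul_pow]
  by_cases hs : s = 0
  · simp [hs]
  · field_simp
    ring

theorem signBit_ne_of_mul_neg (tie : Bool) {A B : ℝ} (h : A * B < 0) :
    signBit tie A ≠ signBit tie B := by
  rcases mul_neg_iff.1 h with ⟨h1, h2⟩ | ⟨h1, h2⟩
  · simp [signBit, h1, h2, h2.le.not_gt]
  · simp [signBit, h1, h2, h1.le.not_gt]

theorem mul_nonpos_of_signBit_ne {tie : Bool} {A B : ℝ} (h : signBit tie A ≠ signBit tie B) :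
    A * B ≤ 0 := by
  by_contra! hpos
  rcases mul_pos_iff.1 hpos with ⟨h1, h2⟩ | ⟨h1, h2⟩
  · simp [signBit, h1, h2] at h
  · simp [signBit, h1, h2, h1.le.not_gt, h2.le.not_gt] at h

/-- The probability, over a uniformly random boolean function, that the optimal predictor is
sensitive to the bit `i` at the input `x`. -/
noncomputable def flipProb {n : ℕ} (tie : Bool) (p : ℝ) (x : Fin n → Bool) (i : Fin n) : ℝ :=
  𝔼 f : BoolFun n, if optPredictor tie p f x ≠ optPredictor tie p f (flipBit i x) then 1 else 0

theorem flipProb_bounds {n : ℕ} (tie : Bool) {p : ℝ} (hp : 1 - 2 * p ≠ 0)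
    (x : Fin (n + 1) → Bool) (i : Fin (n + 1)) :
    (rademacherLaw (neighborWeight p x i)).real
        {w : ℂ | w.re ^ 2 < (1 - 2 * p) ^ 2 * w.im ^ 2} ≤ flipProb tie p x i ∧
      flipProb tie p x i ≤ (rademacherLaw (neighborWeight p x i)).real
        {w : ℂ | w.re ^ 2 ≤ (1 - 2 * p) ^ 2 * w.im ^ 2} := by
  classical
  have hQ := sq_add_one_sub_sq_pos p
  have hs : 0 < √(2 * (p ^ 2 + (1 - p) ^ 2) ^ n) := by positivity
  have h4 : 0 < 4 / √(2 * (p ^ 2 + (1 - p) ^ 2) ^ n) ^ 2 := by positivity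
  rw [rademacherLaw_real_apply _ (measurableSet_lt (by fun_prop) (by fun_prop)),
    rademacherLaw_real_apply _ (measurableSet_le (by fun_prop) (by fun_prop))]
  simp only [sum_pmOne_smul_neighborWeight, Set.mem_ofPred_eq, flipProb]
  constructor
  · refine Finset.expect_le_expect fun f _ => ?_
    simp only [← sub_neg (a := (_ / _) ^ 2), sq_normalized_sub _ _ hp]
    split_ifs with h1 h2 h2
    · exact le_rfl
    · exact absurd (signBit_ne_of_mul_neg tie ((smul_neg_iff_of_pos_left h4).1 h1)) h2
    · exact zero_le_one
    · exact le_rfl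
  · refine Finset.expect_le_expect fun f _ => ?_
    simp only [← sub_nonpos (a := (_ / _) ^ 2), sq_normalized_sub _ _ hp]
    split_ifs with h1 h2 h2
    · exact le_rfl
    · exact absurd (mul_nonpos_of_nonneg_of_nonpos h4.le (mul_nonpos_of_signBit_ne h1)) h2
    · exact zero_le_one
    · exact le_rfl

/-- Arbitrary sequences of inputs and positions are allowed, so that the worst pair can be chosen
for each `n`. -/
theorem tendsto_flipProb (tie : Bool) {p : ℝ} (h0 : 0 < p) (h1 : p < 1) (hp : 1 - 2 * p ≠ 0)
    (x : ∀ n : ℕ, Fin (n + 1) → Bool) (i : ∀ n : ℕ, Fin (n + 1)) :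
    Tendsto (fun n => flipProb tie p (x n) (i n)) atTop
      (𝓝 (2 * Real.arctan |1 - 2 * p| / Real.pi)) := by
  obtain ⟨hl, hu⟩ := tendsto_rademacherLaw_sector (fun n => neighborWeight p (x n) (i n)) _
    (tendsto_neighborWeight_bound h0 h1)
    (fun n z => norm_neighborWeight_le h0.le h1.le (x n) (i n) z)
    (fun n t => sum_inner_neighborWeight_sq hp (x n) (i n) t) hp
  exact tendsto_of_tendsto_of_tendsto_of_le_of_le hl hu
    (fun n => (flipProb_bounds tie hp (x n) (i n)).1)
    fun n => (flipProb_bounds tie hp (x n) (i n)).2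

theorem arccos_eq_two_mul_arctan (p : ℝ) :
    Real.arccos (2 * p * (1 - p) / (p ^ 2 + (1 - p) ^ 2)) = 2 * Real.arctan |1 - 2 * p| := by
  have hQ := sq_add_one_sub_sq_pos p
  have h : 2 * p * (1 - p) / (p ^ 2 + (1 - p) ^ 2) = Real.cos (2 * Real.arctan |1 - 2 * p|) := by
    rw [Real.cos_two_mul, Real.cos_sq_arctan, sq_abs]
    have h2 : 1 + (1 - 2 * p) ^ 2 ≠ 0 := by positivity
    rw [div_eq_iff hQ.ne']
    field_simp
    ring
  have h3 : 0 ≤ Real.arctan |1 - 2 * p| := Real.arctan_nonneg.2 (abs_nonneg _)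
  rw [h, Real.arccos_cos (by linarith) (by linarith [Real.arctan_lt_pi_div_two |1 - 2 * p|])]

/-- The normalised expected sensitivity converges when the noise is nontrivial. -/
theorem tendsto_expect_avgSensitivity_div (tie : Bool) {p : ℝ} (h0 : 0 < p) (h1 : p < 1)
    (hp : 1 - 2 * p ≠ 0) :
    Tendsto (fun n : ℕ => (𝔼 f : BoolFun n, avgSensitivity (optPredictor tie p f)) / n) atTop
      (𝓝 (Real.arccos (2 * p * (1 - p) / (p ^ 2 + (1 - p) ^ 2)) / Real.pi)) := by
  rw [← tendsto_add_atTop_iff_nat 1, arccos_eq_two_mul_arctan]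
  set L := 2 * Real.arctan |1 - 2 * p| / Real.pi
  -- The pair farthest from the limit controls the average over all pairs, giving uniformity without
  -- a convergence rate.
  have hmax : ∀ n : ℕ, ∃ q : (Fin (n + 1) → Bool) × Fin (n + 1),
      ∀ q' : (Fin (n + 1) → Bool) × Fin (n + 1),
        |flipProb tie p q'.1 q'.2 - L| ≤ |flipProb tie p q.1 q.2 - L| :=
    fun n => Finite.exists_max _
  choose q hq using hmax
  have hlim := (tendsto_flipProb tie h0 h1 hp (fun n => (q n).1) fun n => (q n).2)
  rw [tendsto_iff_norm_sub_tendsto_zero] at hlim ⊢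
  refine squeeze_zero (fun _ => norm_nonneg _) (fun n => ?_) hlim
  simp only [Real.norm_eq_abs]
  have hn : (0 : ℝ) < ((n + 1 : ℕ) : ℝ) := by positivity
  rw [expect_avgSensitivity]
  have e : (𝔼 x : Fin (n + 1) → Bool, ∑ i, flipProb tie p x i) / ((n + 1 : ℕ) : ℝ) - L =
      (𝔼 x : Fin (n + 1) → Bool, ∑ i, (flipProb tie p x i - L)) / ((n + 1 : ℕ) : ℝ) := by
    simp only [Finset.sum_sub_distrib, Finset.expect_sub_distrib, Finset.sum_const,
      Finset.card_univ, Fintype.card_fin, nsmul_eq_mul, Fintype.expect_const]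
    field_simp
  change |(𝔼 x : Fin (n + 1) → Bool, ∑ i, flipProb tie p x i) / ((n + 1 : ℕ) : ℝ) - L| ≤ _
  rw [e, abs_div, abs_of_pos hn, div_le_iff₀ hn]
  refine (Finset.abs_expect_le _ _).trans ?_
  refine Finset.expect_le Finset.univ_nonempty fun x _ => ?_
  refine (Finset.abs_sum_le_sum_abs _ _).trans ?_
  refine (Finset.sum_le_card_nsmul _ _ _ fun i _ => hq n (x, i)).trans ?_
  rw [Finset.card_univ, Fintype.card_fin, nsmul_eq_mul, mul_comm]

/-! ### Degenerate noise rates -/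

theorem signBit_pmOne (tie b : Bool) : signBit tie (pmOne b) = b := by
  cases b <;> simp [signBit, pmOne]

theorem noiseOp_one {n : ℕ} (g : (Fin n → Bool) → ℝ) (x : Fin n → Bool) :
    noiseOp 1 g x = g x := by
  rw [noiseOp, Finset.sum_eq_single x]
  · simp [noiseKernel]
  · intro z _ hz
    obtain ⟨i, hi⟩ := Function.ne_iff.1 hz
    rw [noiseKernel, Finset.prod_eq_zero (Finset.mem_univ i) (by simp [hi]), zero_mul]
  · simp

theorem noiseOp_neg_one {n : ℕ} (g : (Fin n → Bool) → ℝ) (x : Fin n → Bool) :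
    noiseOp (-1) g x = g fun i => !(x i) := by
  rw [noiseOp, Finset.sum_eq_single fun i => !(x i)]
  · simp [noiseKernel]
  · intro z _ hz
    obtain ⟨i, hi⟩ := Function.ne_iff.1 hz
    have hi' : z i = x i := by
      revert hi
      cases z i <;> cases x i <;> simp
    rw [noiseKernel, Finset.prod_eq_zero (Finset.mem_univ i) (by simp [hi']), zero_mul]
  · simp

theorem noiseOp_zero {n : ℕ} (g : (Fin n → Bool) → ℝ) (x y : Fin n → Bool) :
    noiseOp 0 g x = noiseOp 0 g y := by
  simp [noiseOp, noiseKernel]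

theorem expect_avgSensitivity_optPredictor_zero (tie : Bool) (n : ℕ) :
    (𝔼 f : BoolFun n, avgSensitivity (optPredictor tie 0 f)) = (n : ℝ) / 2 :=
  expect_avgSensitivity_comp _ id Function.injective_id fun f x => by
    simp [optPredictor, noiseOp_one, signBit_pmOne]

theorem expect_avgSensitivity_optPredictor_one (tie : Bool) (n : ℕ) :
    (𝔼 f : BoolFun n, avgSensitivity (optPredictor tie 1 f)) = (n : ℝ) / 2 := by
  refine expect_avgSensitivity_comp _ (fun x i => !(x i)) (fun x y h => ?_) fun f x => ?_
  · funext i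
    simpa using congrFun h i
  · have h : (1 - 2 * 1 : ℝ) = -1 := by norm_num
    rw [optPredictor, h, noiseOp_neg_one, signBit_pmOne]

theorem expect_avgSensitivity_optPredictor_half (tie : Bool) (n : ℕ) :
    (𝔼 f : BoolFun n, avgSensitivity (optPredictor tie (1 / 2) f)) = 0 := by
  rw [expect_avgSensitivity]
  refine Finset.expect_eq_zero fun x _ => Finset.sum_eq_zero fun i _ =>
    Finset.expect_eq_zero fun f _ => ?_
  have h : (1 - 2 * (1 / 2) : ℝ) = 0 := by norm_num
  simp only [optPredictor, h]
  rw [noiseOp_zero _ x (flipBit i x)]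
  simp

theorem proposition2 (tie : Bool) :
    (∀ p : ℝ, 0 ≤ p → p ≤ 1 →
      Asymptotics.IsEquivalent Filter.atTop
        (fun n : ℕ => 𝔼 f : BoolFun n, avgSensitivity (optPredictor tie p f))
        (fun n : ℕ => (n : ℝ) / Real.pi *
          Real.arccos (2 * p * (1 - p) / (p ^ 2 + (1 - p) ^ 2)))) ∧
    (∀ n : ℕ, (𝔼 f : BoolFun n, avgSensitivity f) = (n : ℝ) / 2) ∧
    (∀ p : ℝ, 0 < p → p ≤ 1 / 2 →
      ∀ᶠ n : ℕ in Filter.atTop,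
        (𝔼 f : BoolFun n, avgSensitivity (optPredictor tie p f)) <
          𝔼 f : BoolFun n, avgSensitivity f) := by
  have hhalf : ∀ n : ℕ, (𝔼 f : BoolFun n, avgSensitivity f) = (n : ℝ) / 2 := fun n =>
    expect_avgSensitivity_comp (fun f => f) id Function.injective_id fun _ _ => rfl
  refine ⟨fun p h0 h1 => ?_, hhalf, fun p h0 h1 => ?_⟩
  · rcases h0.eq_or_lt with rfl | h0
    · refine Filter.EventuallyEq.isEquivalent (Eventually.of_forall fun n => ?_)
      simp only [expect_avgSensitivity_optPredictor_zero]
      norm_num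
      field_simp
    rcases h1.eq_or_lt with rfl | h1
    · refine Filter.EventuallyEq.isEquivalent (Eventually.of_forall fun n => ?_)
      simp only [expect_avgSensitivity_optPredictor_one]
      norm_num
      field_simp
    by_cases hp : 1 - 2 * p = 0
    · obtain rfl : p = 1 / 2 := by linarith
      refine Filter.EventuallyEq.isEquivalent (Eventually.of_forall fun n => ?_)
      simp only [expect_avgSensitivity_optPredictor_half]
      norm_num
    · have hα : 0 < Real.arctan |1 - 2 * p| := Real.arctan_pos.2 (abs_pos.2 hp)
      -- A nonzero limit is what turns convergence of the ratio into asymptotic equivalence; this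
      -- excludes `p = 1/2`.
      have hL : Real.arccos (2 * p * (1 - p) / (p ^ 2 + (1 - p) ^ 2)) / Real.pi ≠ 0 := by
        rw [arccos_eq_two_mul_arctan]
        positivity
      have h := (Asymptotics.isEquivalent_const_iff_tendsto hL).2
        (tendsto_expect_avgSensitivity_div tie h0 h1 hp)
      have h2 := (Asymptotics.IsEquivalent.refl (u := fun n : ℕ => (n : ℝ)) (l := atTop)).mul h
      refine (h2.congr_left ?_).congr_right ?_
      · filter_upwards [eventually_gt_atTop 0] with n hn
        have : (n : ℝ) ≠ 0 := by positivity
        simp only [Pi.mul_apply]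
        field_simp
      · refine Eventually.of_forall fun n => ?_
        simp only [Pi.mul_apply, Function.const_apply]
        ring
  · rcases h1.eq_or_lt with rfl | h1
    · filter_upwards [eventually_gt_atTop 0] with n hn
      rw [hhalf, expect_avgSensitivity_optPredictor_half]
      positivity
    · have hlt : Real.arccos (2 * p * (1 - p) / (p ^ 2 + (1 - p) ^ 2)) / Real.pi < 1 / 2 := by
        have hpos : 0 < 2 * p * (1 - p) / (p ^ 2 + (1 - p) ^ 2) := by
          have := sq_add_one_sub_sq_pos p
          have : 0 < 1 - p := by linarith
          positivity
        rw [div_lt_iff₀ Real.pi_pos]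
        linarith [Real.arccos_lt_pi_div_two.2 hpos]
      have h := tendsto_expect_avgSensitivity_div tie h0 (by linarith) (by linarith)
      filter_upwards [h.eventually_lt_const hlt, eventually_gt_atTop 0] with n hn hn0
      have : (0 : ℝ) < n := by positivity
      rw [div_lt_iff₀ this] at hn
      rw [hhalf]
      linarith
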